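/- Let $D$ be an integral domain with quotient field $K$. Write $\overline{F}(D)$ for the set of nonzero $D$-submodules of $K$, and $(A:B)=\{x\in K\mid xB\subseteq A\}$ for $D$-submodules $A,B$ of $K$. A semistar operation on $D$ is a map $\overline{F}(D)\to\overline{F}(D)$, $E\mapsto E^\star$, such that for all nonzero $x\in K$ and all $E,F\in\overline{F}(D)$: $(xE)^\star=xE^\star$; $E\subseteq F$ implies $E^\star\subseteq F^\star$; $E\subseteq E^\star$ and $(E^\star)^\star=E^\star$. The associated finite-type operation $\star_f$ is given by $E^{\star_f}=\bigcup\{F^\star\mid F\in\overline{F}(D)\text{ finitely generated},\ F\subseteq E\}$. A quasi-$\star_f$-maximal ideal is an ideal of $D$ that is maximal among the nonzero proper ideals $I$ of $D$ with $I=I^{\star_f}\cap D$ (such an ideal is prime). The domain $D$ is $\star_f$-sharp if for every quasi-$\star_f$-maximal ideal $P$ the intersection $\bigcap D_M$ (in $K$, and equal to $K$ if it is empty), taken over all quasi-$\star_f$-maximal ideals $M$ with $M\not\supseteq P$, is not contained in $D_P$. The domain $D$ is a P$\star$MD (Prüfer $\star$-multiplication domain) if $(F(D:F))^{\star_f}=D^{\star_f}$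 for each finitely generated $F\in\overline{F}(D)$. An element $E\in\overline{F}(D)$ is $\star_f$-idempotent if $E^{\star_f}=(E^2)^{\star_f}$. (1) Let $\star$ be a semistar operation on $D$ such that $D$ is a $\star_f$-sharp P$\star$MD, and let $I$ be a nonzero ideal of $D$ with $(D^\star:I)=D^\star$. Then $I$ is $\star_f$-idempotent. (2) Let $v$ be the semistar operation $E\mapsto E^v=(D:(D:E))$ and let $t=v_f$. A P$v$MD is a domain in which $(I(D:I))^t=D$ for each nonzero finitely generated ideal $I$. If $D$ is a $t$-sharp P$v$MD (that is, $D$ is a P$v$MD and is $v_f$-sharp) and $I$ is a nonzero ideal of $D$ with $I^{-1}=(D:I)=D$, then $I$ is $t$-idempotent. -/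

import Mathlib

open scoped Pointwise

/-- A semistar operation on the integral domain `D` with quotient field `K`: a map `E ↦ E^⋆` on the
nonzero `D`-submodules of `K` subject to the three axioms below. The map is written as a total
function on submodules; its value at the zero submodule is unconstrained and is never used.
(That `E^⋆` is nonzero follows from `le_map`.) -/
structure SemistarOperation (D K : Type*) [CommRing D] [Field K] [Algebra D K] where
  toFun : Submodule D K → Submodule D K
  map_smul' : ∀ (x : K) (E : Submodule D K), x ≠ 0 → E ≠ ⊥ → toFun (x • E) = x • toFun E
  mono' : ∀ E F : Submodule D K, E ≠ ⊥ → F ≠ ⊥ → E ≤ F → toFun E ≤ toFun F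
  le_map' : ∀ E : Submodule D K, E ≠ ⊥ → E ≤ toFun E
  idem' : ∀ E : Submodule D K, E ≠ ⊥ → toFun (toFun E) = toFun E

namespace SemistarOperation

section

variable {D K : Type*} [CommRing D] [Field K] [Algebra D K]

instance : CoeFun (SemistarOperation D K) (fun _ => Submodule D K → Submodule D K) :=
  ⟨SemistarOperation.toFun⟩

theorem map_ne_bot (s : SemistarOperation D K) {E : Submodule D K} (hE : E ≠ ⊥) : s E ≠ ⊥ :=
  fun h => hE (le_bot_iff.mp (h ▸ s.le_map' E hE))

theorem smul_ne_bot {x : K} (hx : x ≠ 0) {E : Submodule D K} (hE : E ≠ ⊥) : x • E ≠ ⊥ := by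
  obtain ⟨y, hy, hy0⟩ := (Submodule.ne_bot_iff E).mp hE
  exact (Submodule.ne_bot_iff _).mpr
    ⟨x • y, Submodule.smul_mem_pointwise_smul y x E hy, by simp [hx, hy0]⟩

theorem fg_smul (x : K) {E : Submodule D K} (hE : E.FG) : (x • E).FG :=
  hE.map _

/-- The finitely generated nonzero `D`-submodules of `K` contained in `E`. -/
def fgBelow (E : Submodule D K) : Set (Submodule D K) :=
  {F | F ≠ ⊥ ∧ F.FG ∧ F ≤ E}

theorem fgBelow_nonempty {E : Submodule D K} (hE : E ≠ ⊥) : (fgBelow E).Nonempty := by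
  obtain ⟨y, hy, hy0⟩ := (Submodule.ne_bot_iff E).mp hE
  exact ⟨D ∙ y, by simpa using hy0, Submodule.fg_span_singleton y, by simpa using hy⟩

theorem directedOn_fgBelow (s : SemistarOperation D K) (E : Submodule D K) :
    DirectedOn (· ≤ ·) (s '' fgBelow E) := by
  rintro _ ⟨F, ⟨hF0, hF, hFE⟩, rfl⟩ _ ⟨G, ⟨hG0, hG, hGE⟩, rfl⟩
  have h0 : F ⊔ G ≠ ⊥ := fun h => hF0 (le_bot_iff.mp (h ▸ le_sup_left))
  exact ⟨s (F ⊔ G), ⟨F ⊔ G, ⟨h0, hF.sup hG, sup_le hFE hGE⟩, rfl⟩,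
    s.mono' _ _ hF0 h0 le_sup_left, s.mono' _ _ hG0 h0 le_sup_right⟩

/-- The supremum of the `F^⋆`, for `F` nonzero, finitely generated and contained in the nonzero
submodule `E`, is their union. -/
theorem mem_sSup_fgBelow (s : SemistarOperation D K) {E : Submodule D K} (hE : E ≠ ⊥) {x : K} :
    x ∈ sSup (s '' fgBelow E) ↔ ∃ F : Submodule D K, F ≠ ⊥ ∧ F.FG ∧ F ≤ E ∧ x ∈ s F := by
  rw [Submodule.mem_sSup_of_directed ((fgBelow_nonempty hE).image _) (s.directedOn_fgBelow E)]
  constructor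
  · rintro ⟨_, ⟨F, ⟨h0, h1, h2⟩, rfl⟩, hx⟩
    exact ⟨F, h0, h1, h2, hx⟩
  · rintro ⟨F, h0, h1, h2, hx⟩
    exact ⟨s F, ⟨F, ⟨h0, h1, h2⟩, rfl⟩, hx⟩

theorem le_sSup_fgBelow (s : SemistarOperation D K) {E : Submodule D K} (hE : E ≠ ⊥) :
    E ≤ sSup (s '' fgBelow E) := by
  intro x hx
  rw [s.mem_sSup_fgBelow hE]
  by_cases hx0 : x = 0
  · obtain ⟨F, h0, h1, h2⟩ := fgBelow_nonempty hE
    exact ⟨F, h0, h1, h2, hx0 ▸ Submodule.zero_mem _⟩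
  · have h0 : (D ∙ x) ≠ ⊥ := by simpa using hx0
    exact ⟨D ∙ x, h0, Submodule.fg_span_singleton x, by simpa using hx,
      s.le_map' _ h0 (Submodule.mem_span_singleton_self x)⟩

theorem sSup_fgBelow_ne_bot (s : SemistarOperation D K) {E : Submodule D K} (hE : E ≠ ⊥) :
    sSup (s '' fgBelow E) ≠ ⊥ :=
  fun h => hE (le_bot_iff.mp (h ▸ s.le_sSup_fgBelow hE))

theorem sSup_fgBelow_smul_le (s : SemistarOperation D K) {x : K} (hx : x ≠ 0)
    {E : Submodule D K} (hE : E ≠ ⊥) :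
    x • sSup (s '' fgBelow E) ≤ sSup (s '' fgBelow (x • E)) := by
  rintro _ ⟨y, hy, rfl⟩
  obtain ⟨F, h0, h1, h2, hyF⟩ := (s.mem_sSup_fgBelow hE).mp hy
  refine (s.mem_sSup_fgBelow (smul_ne_bot hx hE)).mpr
    ⟨x • F, smul_ne_bot hx h0, fg_smul x h1, Submodule.map_mono h2, ?_⟩
  rw [s.map_smul' x F hx h0]
  exact Submodule.smul_mem_pointwise_smul y x _ hyF

/-- The finite-type semistar operation `⋆_f` associated with `⋆`: `E^{⋆_f}` is the union of the
`F^⋆`, where `F` runs through the nonzero finitely generated submodules of `E`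
(see `mem_sSup_fgBelow`). -/
def finiteType (s : SemistarOperation D K) : SemistarOperation D K where
  toFun E := sSup (s '' fgBelow E)
  map_smul' x E hx hE := by
    refine le_antisymm ?_ (s.sSup_fgBelow_smul_le hx hE)
    have h := s.sSup_fgBelow_smul_le (inv_ne_zero hx) (smul_ne_bot hx hE)
    rw [inv_smul_smul₀ hx] at h
    have h' : x • x⁻¹ • sSup (s '' fgBelow (x • E)) ≤ x • sSup (s '' fgBelow E) :=
      Submodule.map_mono h
    rwa [smul_inv_smul₀ hx] at h'
  mono' E F hE hF hEF := by
    apply sSup_le_sSup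
    rintro _ ⟨G, ⟨h0, h1, h2⟩, rfl⟩
    exact ⟨G, ⟨h0, h1, h2.trans hEF⟩, rfl⟩
  le_map' E hE := s.le_sSup_fgBelow hE
  idem' E hE := by
    refine le_antisymm ?_ (s.le_sSup_fgBelow (s.sSup_fgBelow_ne_bot hE))
    apply sSup_le
    rintro _ ⟨F, ⟨h0, h1, h2⟩, rfl⟩
    obtain ⟨_, ⟨G, hG, rfl⟩, hFG⟩ :=
      ((CompleteLattice.isCompactElement_iff_le_of_directed_sSup_le _ _).mp
        ((Submodule.fg_iff_compact F).mp h1)) _ ((fgBelow_nonempty hE).image _)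
        (s.directedOn_fgBelow E) h2
    calc s F ≤ s (s G) := s.mono' _ _ h0 (s.map_ne_bot hG.1) hFG
      _ = s G := s.idem' G hG.1
      _ ≤ sSup (s '' fgBelow E) := le_sSup (Set.mem_image_of_mem _ hG)

/-- A nonzero ideal `I` of `D` with `I = I^⋆ ∩ D`. -/
def IsQuasiIdeal (s : SemistarOperation D K) (I : Ideal D) : Prop :=
  I ≠ ⊥ ∧ ∀ a : D, algebraMap D K a ∈ s (IsLocalization.coeSubmodule K I) ↔ a ∈ I

/-- A quasi-`⋆`-maximal ideal: maximal in the set of all proper quasi-`⋆`-ideals. -/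
def IsQuasiMaximal (s : SemistarOperation D K) (M : Ideal D) : Prop :=
  Maximal (fun I : Ideal D => s.IsQuasiIdeal I ∧ I ≠ ⊤) M

/-- The localization `D_P` of `D` at a prime ideal `P`, as a subset of `K`: all quotients `a / b`
with `a ∈ D` and `b ∈ D \ P`. -/
def localizationAt (K : Type*) [Field K] [Algebra D K] (P : Ideal D) : Set K :=
  {x | ∃ a b : D, b ∉ P ∧ x = algebraMap D K a / algebraMap D K b}

/-- `∇^⋆(P)`: the quasi-`⋆`-maximal ideals that do not contain `P`. -/
def nabla (s : SemistarOperation D K) (P : Ideal D) : Set (Ideal D) :=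
  {M | s.IsQuasiMaximal M ∧ ¬ P ≤ M}

/-- `Θ^⋆(P)`: the intersection in `K` of the `D_M` with `M ∈ ∇^⋆(P)` (equal to `K` when there is
no such `M`). -/
def theta (s : SemistarOperation D K) (P : Ideal D) : Set K :=
  ⋂ M ∈ s.nabla P, localizationAt K M

/-- `P` is `⋆`-sharp if `Θ^⋆(P)` is not contained in `D_P`. -/
def IsSharpAt (s : SemistarOperation D K) (P : Ideal D) : Prop :=
  ¬ s.theta P ⊆ localizationAt K P

/-- `D` is `⋆`-sharp if each quasi-`⋆`-maximal ideal of `D` is `⋆`-sharp. (Used for finite-type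
operations.) -/
def IsSharp (s : SemistarOperation D K) : Prop :=
  ∀ P : Ideal D, s.IsQuasiMaximal P → s.IsSharpAt P

/-- `E` is `⋆`-idempotent if `E^⋆ = (E^2)^⋆`. -/
def IsIdempotent (s : SemistarOperation D K) (E : Submodule D K) : Prop :=
  s E = s (E ^ 2)

/-- `D` is a Prüfer `⋆`-multiplication domain: `(F F⁻¹)^{⋆_f} = D^{⋆_f}` for every nonzero finitely
generated `D`-submodule `F` of `K`. Here `1 : Submodule D K` is `D` itself, and
`1 / F` is `F⁻¹ = (D : F)`. -/
def IsPStarMD (s : SemistarOperation D K) : Prop :=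
  ∀ F : Submodule D K, F ≠ ⊥ → F.FG → s.finiteType (F * (1 / F)) = s.finiteType 1

/-- `E ⊆ (D : (D : E))`. -/
theorem le_one_div_one_div (E : Submodule D K) : E ≤ 1 / (1 / E) := by
  intro x hx
  rw [Submodule.mem_div_iff_forall_mul_mem]
  intro y hy
  rw [mul_comm]
  exact Submodule.mem_div_iff_forall_mul_mem.mp hy x hx

theorem one_div_anti {E F : Submodule D K} (h : E ≤ F) : 1 / F ≤ 1 / E := by
  intro x hx
  rw [Submodule.mem_div_iff_forall_mul_mem] at hx ⊢
  exact fun y hy => hx y (h hy)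

theorem one_div_smul {x : K} (hx : x ≠ 0) (E : Submodule D K) : 1 / (x • E) = x⁻¹ • (1 / E) := by
  ext y
  rw [Submodule.mem_div_iff_forall_mul_mem]
  constructor
  · intro h
    refine ⟨x * y, ?_, by simp [hx]⟩
    refine Submodule.mem_div_iff_forall_mul_mem.mpr fun z hz => ?_
    have := h (x • z) (Submodule.smul_mem_pointwise_smul z x E hz)
    rwa [smul_eq_mul, ← mul_assoc, mul_comm y x] at this
  · rintro ⟨z, hz, rfl⟩ _ ⟨w, hw, rfl⟩
    have := Submodule.mem_div_iff_forall_mul_mem.mp hz w hw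
    have e : (x⁻¹ * z) * (x * w) = z * w := by field_simp
    simpa [e] using this

/-- The `v`-operation `E ↦ E^v = (E⁻¹)⁻¹ = (D : (D : E))`; a nonzero submodule `E` that is not a
fractional ideal has `(D : E) = 0` and hence `E^v = K`. -/
def vOperation (D K : Type*) [CommRing D] [Field K] [Algebra D K] : SemistarOperation D K where
  toFun E := 1 / (1 / E)
  map_smul' x E hx _ := by
    rw [one_div_smul hx, one_div_smul (inv_ne_zero hx), inv_inv]
  mono' _ _ _ _ h := one_div_anti (one_div_anti h)
  le_map' E _ := le_one_div_one_div E
  idem' E _ := le_antisymm (one_div_anti (le_one_div_one_div (1 / E))) (le_one_div_one_div _)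

/-- The `t`-operation: the finite-type operation associated with `v`. -/
def tOperation (D K : Type*) [CommRing D] [Field K] [Algebra D K] : SemistarOperation D K :=
  (vOperation D K).finiteType

/-- `D` is a P`v`MD: each nonzero finitely generated ideal `I` of `D` is `t`-invertible, that is,
`(I I⁻¹)^t = D`. -/
def IsPvMD (D K : Type*) [CommRing D] [Field K] [Algebra D K] : Prop :=
  ∀ I : Ideal D, I ≠ ⊥ → I.FG →
    tOperation D K (IsLocalization.coeSubmodule K I * (1 / IsLocalization.coeSubmodule K I)) = 1

end

end SemistarOperation

namespace SemistarOperation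

open IsLocalization

set_option linter.unusedSectionVars false

section

variable {D K : Type*} [CommRing D] [IsDomain D] [Field K] [Algebra D K] [IsFractionRing D K]

/-! The argument is local at quasi-`⋆_f`-maximal ideals. An element of `K` lying in `E D_M` for
every such `M` lies in `E^{⋆_f}` (`mem_finiteType_of_forall_isQuasiMaximal`), so if `I` is not
`⋆_f`-idempotent, some `x ∈ I` avoids `I² D_M` for some `M`. In a P⋆MD, `D_M` is a valuation domain
`V` containing `D^⋆` (`IsPStarMD.mem_or_inv_mem_localizationAt`,
`IsPStarMD.map_one_subset_localizationAt`). In `V`, non-idempotence forces `(V : I) ≠ V`. Sharpness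
at `M` then moves an element of `(V : I)` outside `V` into all `D_N` with `N ≠ M`. The resulting `y`
satisfies `yI ⊆ D_N` for every `N`, hence `yI ⊆ D^⋆`, so `y ∈ (D^⋆ : I) = D^⋆ ⊆ V`, a contradiction.
The statement for `t` is the case `⋆ = v`, where `D^v = D`. -/

theorem one_mem_one_submodule : (1 : K) ∈ (1 : Submodule D K) :=
  Submodule.mem_one.mpr ⟨1, map_one _⟩

theorem coeSubmodule_ne_bot {I : Ideal D} (hI : I ≠ ⊥) : coeSubmodule K I ≠ ⊥ := by
  obtain ⟨a, ha, ha0⟩ := (Submodule.ne_bot_iff I).mp hI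
  refine (Submodule.ne_bot_iff _).mpr ⟨algebraMap D K a, (mem_coeSubmodule K I).mpr ⟨a, ha, rfl⟩, ?_⟩
  simpa using ha0

theorem algebraMap_mem_coeSubmodule {I : Ideal D} {a : D} :
    algebraMap D K a ∈ coeSubmodule K I ↔ a ∈ I := by
  rw [mem_coeSubmodule]
  constructor
  · rintro ⟨b, hb, h⟩
    exact IsFractionRing.injective D K h ▸ hb
  · exact fun h => ⟨a, h, rfl⟩

theorem coeSubmodule_pow_two (I : Ideal D) : coeSubmodule K I ^ 2 = coeSubmodule K (I ^ 2) := by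
  rw [pow_two, pow_two, coeSubmodule_mul]

/-! ### Localizations inside `K`. -/

theorem algebraMap_ne_zero_of_notMem {M : Ideal D} {b : D} (hb : b ∉ M) : algebraMap D K b ≠ 0 := by
  intro h
  have : b = 0 := by simpa using h
  exact hb (this ▸ M.zero_mem)

theorem algebraMap_mem_localizationAt {M : Ideal D} (hM : M.IsPrime) (a : D) :
    algebraMap D K a ∈ localizationAt K M :=
  ⟨a, 1, fun h => hM.ne_top ((Ideal.eq_top_iff_one M).mpr h), by simp⟩

theorem mul_mem_localizationAt {M : Ideal D} (hM : M.IsPrime) {x y : K}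
    (hx : x ∈ localizationAt K M) (hy : y ∈ localizationAt K M) : x * y ∈ localizationAt K M := by
  obtain ⟨a, b, hb, rfl⟩ := hx
  obtain ⟨c, d, hd, rfl⟩ := hy
  exact ⟨a * c, b * d, fun h => (hM.mem_or_mem h).elim hb hd, by
    rw [map_mul, map_mul, div_mul_div_comm]⟩

theorem mem_localizationAt_of_mul_mem {M : Ideal D} (hM : M.IsPrime) {b : D} (hb : b ∉ M) {x : K}
    (hx : algebraMap D K b * x ∈ localizationAt K M) : x ∈ localizationAt K M := by
  have hb0 := algebraMap_ne_zero_of_notMem (K := K) hb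
  have h : (algebraMap D K 1 / algebraMap D K b) ∈ localizationAt K M := ⟨1, b, hb, rfl⟩
  have := mul_mem_localizationAt hM h hx
  rwa [map_one, one_div, inv_mul_cancel_left₀ hb0] at this

/-- If a non-idempotent ideal `I` of `D` generates a non-idempotent ideal of the valuation domain
`V = D_M`, then `(V : I)` is larger than `V`. -/
theorem exists_notMem_localizationAt_of_not_idempotent {M : Ideal D} (hM : M.IsPrime)
    (hV : ∀ x : K, x ≠ 0 → x ∈ localizationAt K M ∨ x⁻¹ ∈ localizationAt K M)
    {I : Ideal D} {x : D} (hx : x ∈ I) (hx2 : ∀ b ∉ M, b * x ∉ I ^ 2) :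
    ∃ z : K, z ∉ localizationAt K M ∧ ∀ i ∈ I, z * algebraMap D K i ∈ localizationAt K M := by
  have hM1 : (1 : D) ∉ M := fun h => hM.ne_top ((Ideal.eq_top_iff_one M).mpr h)
  have hx0 : algebraMap D K x ≠ 0 := by
    intro h
    have h : x = 0 := by simpa using h
    exact hx2 1 hM1 (by simp [h])
  by_cases hdiv : ∀ a ∈ I, algebraMap D K a / algebraMap D K x ∈ localizationAt K M
  -- Here `I V = xV`. If `1/x` were in `V`, then `x` would be a unit of `V`, and `x = x² · (1/x)`
  -- would lie in `I² V`, against `hx2`.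
  · refine ⟨(algebraMap D K x)⁻¹, ?_, fun i hi => by
      simpa [div_eq_mul_inv, mul_comm] using hdiv i hi⟩
    rintro ⟨c, b, hb, h⟩
    have hb0 := algebraMap_ne_zero_of_notMem (K := K) hb
    have e : b = x * c := by
      apply IsFractionRing.injective D K
      rw [map_mul]
      field_simp at h
      rw [h]
    refine hx2 b hb ?_
    have : b * x = c * (x * x) := by rw [e]; ring
    rw [this, pow_two]
    exact Ideal.mul_mem_left _ _ (Ideal.mul_mem_mul hx hx)
  · push Not at hdiv
    obtain ⟨a, ha, haV⟩ := hdiv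
    -- The witness is `a/x`. If `ai/x ∉ V`, its inverse `x/(ai)` lies in `V`, so `x ∈ aiV ⊆ I² V`,
    -- against `hx2`.
    refine ⟨_, haV, fun i hi => ?_⟩
    by_cases h0 : algebraMap D K a / algebraMap D K x * algebraMap D K i = 0
    · rw [h0, ← map_zero (algebraMap D K)]
      exact algebraMap_mem_localizationAt hM 0
    refine (hV _ h0).resolve_right ?_
    rintro ⟨c, b, hb, h⟩
    have hb0 := algebraMap_ne_zero_of_notMem (K := K) hb
    have ha0 : algebraMap D K a ≠ 0 := fun h => h0 (by simp [h])
    have hi0 : algebraMap D K i ≠ 0 := fun h => h0 (by simp [h])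
    have e : b * x = c * (a * i) := by
      apply IsFractionRing.injective D K
      simp only [map_mul]
      field_simp at h
      linear_combination h
    refine hx2 b hb ?_
    rw [e, pow_two]
    exact Ideal.mul_mem_left _ _ (Ideal.mul_mem_mul ha hi)

/-- An element of `(V : I)` outside the valuation domain `V = D_M` can be replaced by one that lies
in a given intersection of localizations, provided that intersection is not contained in `V`. -/
theorem exists_mem_theta_notMem_localizationAt (σ : SemistarOperation D K)
    (hprime : ∀ N, σ.IsQuasiMaximal N → N.IsPrime) {M : Ideal D} (hM : σ.IsQuasiMaximal M)
    (hV : ∀ x : K, x ≠ 0 → x ∈ localizationAt K M ∨ x⁻¹ ∈ localizationAt K M)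
    (hsharp : σ.IsSharpAt M) {I : Ideal D} {z : K} (hz : z ∉ localizationAt K M)
    (hzI : ∀ i ∈ I, z * algebraMap D K i ∈ localizationAt K M) :
    ∃ y ∈ σ.theta M, y ∉ localizationAt K M ∧
      ∀ i ∈ I, y * algebraMap D K i ∈ localizationAt K M := by
  have hMp := hprime M hM
  obtain ⟨u, hu, huM⟩ := Set.not_subset.mp hsharp
  have h0 : (0 : K) ∈ localizationAt K M := by
    simpa using algebraMap_mem_localizationAt (K := K) hMp 0
  have hu0 : u ≠ 0 := fun h => huM (h ▸ h0)
  have hz0 : z ≠ 0 := fun h => hz (h ▸ h0)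
  -- Whichever of `z`, `u` divides the other in `V` decides the witness. If `z/u = a/b`, take `au =
  -- bz`: the left form lies in `theta`, and the right form is `z` up to a unit of `V`. If `u/z ∈
  -- V`, take `u` itself, since `uI ⊆ zIV ⊆ V`.
  rcases hV (z / u) (div_ne_zero hz0 hu0) with ⟨a, b, hb, h⟩ | h
  · have hb0 := algebraMap_ne_zero_of_notMem (K := K) hb
    have e : algebraMap D K a * u = algebraMap D K b * z := by
      field_simp at h
      linear_combination -h
    refine ⟨algebraMap D K a * u, ?_, ?_, ?_⟩
    · refine Set.mem_iInter₂.mpr fun N hN => ?_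
      have hNp := hprime N hN.1
      exact mul_mem_localizationAt hNp (algebraMap_mem_localizationAt hNp a)
        (Set.mem_iInter₂.mp hu N hN)
    · rw [e]
      exact fun h => hz (mem_localizationAt_of_mul_mem hMp hb h)
    · intro i hi
      rw [e, mul_assoc]
      exact mul_mem_localizationAt hMp (algebraMap_mem_localizationAt hMp b) (hzI i hi)
  · refine ⟨u, hu, huM, fun i hi => ?_⟩
    have := mul_mem_localizationAt hMp h (hzI i hi)
    rwa [inv_div, ← mul_assoc, div_mul_cancel₀ u hz0] at this

/-! ### Closures and quasi-maximal ideals. -/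

/-- From `1 ∈ J^σ` follows `x ∈ x J^σ = (xJ)^σ ⊆ E^σ`. -/
theorem mem_map_of_smul_mem (σ : SemistarOperation D K) {J : Ideal D} (hJ : J ≠ ⊥)
    (h1 : (1 : K) ∈ σ (coeSubmodule K J)) {E : Submodule D K} (hE : E ≠ ⊥) {x : K}
    (hx : ∀ j ∈ J, x * algebraMap D K j ∈ E) : x ∈ σ E := by
  by_cases hx0 : x = 0
  · exact hx0 ▸ Submodule.zero_mem _
  have hJ0 := coeSubmodule_ne_bot (K := K) hJ
  have hle : x • coeSubmodule K J ≤ E := by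
    rintro _ ⟨y, hy, rfl⟩
    obtain ⟨j, hj, rfl⟩ := (mem_coeSubmodule K J).mp hy
    exact hx j hj
  apply σ.mono' _ _ (smul_ne_bot hx0 hJ0) hE hle
  rw [σ.map_smul' x _ hx0 hJ0]
  simpa using Submodule.smul_mem_pointwise_smul (1 : K) x _ h1

theorem mul_mem_map_of_mem_map_one (σ : SemistarOperation D K) {E : Submodule D K} (hE : E ≠ ⊥)
    {x e : K} (hx : x ∈ σ 1) (he : e ∈ E) : x * e ∈ σ E := by
  by_cases he0 : e = 0
  · simp [he0]
  have h1 : (1 : Submodule D K) ≠ ⊥ := one_ne_zero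
  have hle : e • (1 : Submodule D K) ≤ E := by
    rintro _ ⟨y, hy, rfl⟩
    obtain ⟨d, rfl⟩ := Submodule.mem_one.mp hy
    have := E.smul_mem d he
    rw [Algebra.smul_def, mul_comm] at this
    exact this
  apply σ.mono' _ _ (smul_ne_bot he0 h1) hE hle
  rw [σ.map_smul' e _ he0 h1, mul_comm]
  exact Submodule.smul_mem_pointwise_smul x e _ hx

theorem one_notMem_map_of_isQuasiMaximal (σ : SemistarOperation D K) {M : Ideal D}
    (hM : σ.IsQuasiMaximal M) : (1 : K) ∉ σ (coeSubmodule K M) := by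
  intro h
  refine hM.prop.2 ((Ideal.eq_top_iff_one M).mpr ((hM.prop.1.2 1).mp ?_))
  rwa [map_one]

/-- The ideal `I^⋆ ∩ D`. -/
def quasiClosure (σ : SemistarOperation D K) (I : Ideal D) : Ideal D :=
  (σ (coeSubmodule K I)).comap (Algebra.linearMap D K)

theorem mem_quasiClosure (σ : SemistarOperation D K) {I : Ideal D} {a : D} :
    a ∈ σ.quasiClosure I ↔ algebraMap D K a ∈ σ (coeSubmodule K I) := Iff.rfl

theorem le_quasiClosure (σ : SemistarOperation D K) {I : Ideal D} (hI : I ≠ ⊥) :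
    I ≤ σ.quasiClosure I := fun _ ha =>
  σ.le_map' _ (coeSubmodule_ne_bot hI) (algebraMap_mem_coeSubmodule.mpr ha)

theorem map_quasiClosure (σ : SemistarOperation D K) {I : Ideal D} (hI : I ≠ ⊥) :
    σ (coeSubmodule K (σ.quasiClosure I)) = σ (coeSubmodule K I) := by
  have hI0 := coeSubmodule_ne_bot (K := K) hI
  have hc : σ.quasiClosure I ≠ ⊥ := fun h => hI (le_bot_iff.mp (h ▸ σ.le_quasiClosure hI))
  have hc0 := coeSubmodule_ne_bot (K := K) hc
  refine le_antisymm ?_ (σ.mono' _ _ hI0 hc0 (coeSubmodule_mono K (σ.le_quasiClosure hI)))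
  conv_rhs => rw [← σ.idem' _ hI0]
  refine σ.mono' _ _ hc0 (σ.map_ne_bot hI0) ?_
  intro y hy
  obtain ⟨a, ha, rfl⟩ := (mem_coeSubmodule K _).mp hy
  exact ha

theorem isQuasiIdeal_quasiClosure (σ : SemistarOperation D K) {I : Ideal D} (hI : I ≠ ⊥) :
    σ.IsQuasiIdeal (σ.quasiClosure I) :=
  ⟨fun h => hI (le_bot_iff.mp (h ▸ σ.le_quasiClosure hI)), fun a => by
    rw [σ.map_quasiClosure hI, mem_quasiClosure]⟩

theorem quasiClosure_ne_top_iff (σ : SemistarOperation D K) {I : Ideal D} :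
    σ.quasiClosure I ≠ ⊤ ↔ (1 : K) ∉ σ (coeSubmodule K I) := by
  rw [Ne, Ideal.eq_top_iff_one, mem_quasiClosure, map_one]

theorem IsQuasiMaximal.one_mem_map_of_lt {σ : SemistarOperation D K} {M : Ideal D}
    (hM : σ.IsQuasiMaximal M) {I : Ideal D} (h : M < I) : (1 : K) ∈ σ (coeSubmodule K I) := by
  have hI : I ≠ ⊥ := (bot_le.trans_lt h).ne'
  by_contra h1
  exact (h.trans_le (σ.le_quasiClosure hI)).not_ge
    (hM.le_of_ge ⟨σ.isQuasiIdeal_quasiClosure hI, σ.quasiClosure_ne_top_iff.mpr h1⟩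
      (h.le.trans (σ.le_quasiClosure hI)))

/-- If `ab ∈ M` and `a ∉ M`, then `J = M + (a)` has `1 ∈ J^σ` by maximality, while `bJ ⊆ M`; hence
`b ∈ M^σ ∩ D = M`. -/
theorem IsQuasiMaximal.isPrime {σ : SemistarOperation D K} {M : Ideal D}
    (hM : σ.IsQuasiMaximal M) : M.IsPrime := by
  refine ⟨hM.prop.2, fun {a b} hab => or_iff_not_imp_left.mpr fun ha => ?_⟩
  have hlt : M < M ⊔ Ideal.span {a} := by
    refine lt_of_le_of_ne le_sup_left fun h => ha ?_
    rw [h]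
    exact Ideal.mem_sup_right (Ideal.mem_span_singleton_self a)
  refine (hM.prop.1.2 b).mp (σ.mem_map_of_smul_mem (bot_le.trans_lt hlt).ne'
    (hM.one_mem_map_of_lt hlt) (coeSubmodule_ne_bot hM.prop.1.1) fun j hj => ?_)
  rw [← map_mul]
  refine algebraMap_mem_coeSubmodule.mpr ?_
  obtain ⟨m, hm, n, hn, rfl⟩ := Submodule.mem_sup.mp hj
  obtain ⟨c, rfl⟩ := Ideal.mem_span_singleton.mp hn
  rw [mul_add]
  refine M.add_mem (M.mul_mem_left _ hm) ?_
  have : b * (a * c) = c * (a * b) := by ring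
  rw [this]
  exact M.mul_mem_left _ hab

theorem IsQuasiMaximal.eq_of_le {σ : SemistarOperation D K} {M N : Ideal D}
    (hM : σ.IsQuasiMaximal M) (hN : σ.IsQuasiMaximal N) (h : M ≤ N) : M = N :=
  le_antisymm h (hM.le_of_ge hN.prop h)

/-! ### Existence of quasi-`⋆_f`-maximal ideals and the local criterion. -/

/-- Finite type is essential: `1 ∈ F^⋆` for a finitely generated `F` inside the union, and by
compactness `F` already lies in one member of the chain. -/
theorem one_notMem_finiteType_sSup (s : SemistarOperation D K) {c : Set (Ideal D)}
    (hc : IsChain (· ≤ ·) c) (hne : c.Nonempty)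
    (h : ∀ L ∈ c, L ≠ ⊥ ∧ (1 : K) ∉ s.finiteType (coeSubmodule K L)) :
    (1 : K) ∉ s.finiteType (coeSubmodule K (sSup c)) := by
  intro h1
  obtain ⟨L₀, hL₀⟩ := hne
  have hsup : sSup c ≠ ⊥ := fun hb => (h L₀ hL₀).1 (le_bot_iff.mp (hb ▸ le_sSup hL₀))
  obtain ⟨F, hF0, hF, hle, hF1⟩ := (s.mem_sSup_fgBelow (coeSubmodule_ne_bot hsup)).mp h1
  have hmap : coeSubmodule K (sSup c) = sSup ((coeSubmodule K) '' c) := by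
    rw [sSup_image, sSup_eq_iSup]
    exact (Submodule.map_iSup _ _).trans (iSup_congr fun _ => Submodule.map_iSup _ _)
  rw [hmap] at hle
  have hdir : DirectedOn (· ≤ ·) ((coeSubmodule K) '' c) := by
    rintro _ ⟨A, hA, rfl⟩ _ ⟨B, hB, rfl⟩
    rcases hc.total hA hB with hAB | hAB
    · exact ⟨_, ⟨B, hB, rfl⟩, coeSubmodule_mono K hAB, le_rfl⟩
    · exact ⟨_, ⟨A, hA, rfl⟩, le_rfl, coeSubmodule_mono K hAB⟩
  obtain ⟨_, ⟨L, hL, rfl⟩, hFL⟩ :=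
    ((CompleteLattice.isCompactElement_iff_le_of_directed_sSup_le _ _).mp
      ((Submodule.fg_iff_compact F).mp hF)) _ (Set.Nonempty.image _ ⟨L₀, hL₀⟩) hdir hle
  exact (h L hL).2 ((s.mem_sSup_fgBelow (coeSubmodule_ne_bot (h L hL).1)).mpr
    ⟨F, hF0, hF, hFL, hF1⟩)

theorem exists_isQuasiMaximal_ge (s : SemistarOperation D K) {J : Ideal D} (hJ : J ≠ ⊥)
    (h1 : (1 : K) ∉ s.finiteType (coeSubmodule K J)) :
    ∃ M, s.finiteType.IsQuasiMaximal M ∧ J ≤ M := by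
  -- Zorn is applied to all nonzero ideals whose closure misses `1`, not only to quasi-ideals; a
  -- maximal one must equal its own quasi-closure.
  obtain ⟨M, hJM, hM⟩ := zorn_le_nonempty₀
    {L : Ideal D | L ≠ ⊥ ∧ (1 : K) ∉ s.finiteType (coeSubmodule K L)}
    (fun c hcs hc L hL => ⟨sSup c, ⟨fun hb => (hcs hL).1 (le_bot_iff.mp (hb ▸ le_sSup hL)),
      s.one_notMem_finiteType_sSup hc ⟨L, hL⟩ fun A hA => hcs hA⟩, fun _ => le_sSup⟩) J ⟨hJ, h1⟩
  have hM0 : M ≠ ⊥ := hM.prop.1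
  have hc := s.finiteType.isQuasiIdeal_quasiClosure hM0
  have heq : s.finiteType.quasiClosure M = M := le_antisymm
    (hM.le_of_ge ⟨hc.1, by rw [map_quasiClosure _ hM0]; exact hM.prop.2⟩
      (le_quasiClosure _ hM0)) (le_quasiClosure _ hM0)
  refine ⟨M, ⟨⟨heq ▸ hc, heq ▸ (quasiClosure_ne_top_iff _).mpr hM.prop.2⟩, ?_⟩, hJM⟩
  rintro L ⟨hL, hLtop⟩ hML
  refine hM.le_of_ge ⟨hL.1, fun h => hLtop ((Ideal.eq_top_iff_one L).mpr ((hL.2 1).mp ?_))⟩ hML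
  rwa [map_one]

theorem mem_finiteType_of_forall_isQuasiMaximal (s : SemistarOperation D K) {E : Submodule D K}
    (hE : E ≠ ⊥) {x : K} (h : ∀ M, s.finiteType.IsQuasiMaximal M →
      ∃ b ∉ M, x * algebraMap D K b ∈ E) : x ∈ s.finiteType E := by
  by_cases hx0 : x = 0
  · exact hx0 ▸ Submodule.zero_mem _
  -- `J` is the conductor `{j ∈ D | xj ∈ E}`. By assumption no quasi-maximal ideal contains it, so
  -- `1 ∈ J^{⋆_f}`.
  let J : Ideal D := E.comap ((LinearMap.mulLeft D x).comp (Algebra.linearMap D K))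
  have hmem : ∀ j, j ∈ J ↔ x * algebraMap D K j ∈ E := fun j => Iff.rfl
  have hJ : J ≠ ⊥ := by
    obtain ⟨e, he, he0⟩ := (Submodule.ne_bot_iff E).mp hE
    obtain ⟨a, b, hb, hab⟩ := IsFractionRing.div_surjective (A := D) (e / x)
    have hb0 : algebraMap D K b ≠ 0 := by simpa using nonZeroDivisors.ne_zero hb
    refine (Submodule.ne_bot_iff J).mpr ⟨a, (hmem a).mpr ?_, fun ha => ?_⟩
    · have : x * algebraMap D K a = b • e := by
        rw [Algebra.smul_def]
        field_simp at hab
        linear_combination hab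
      exact this ▸ E.smul_mem b he
    · rw [ha, map_zero, zero_div] at hab
      exact div_ne_zero he0 hx0 hab.symm
  refine s.finiteType.mem_map_of_smul_mem hJ ?_ hE fun j hj => hj
  by_contra h1
  obtain ⟨M, hM, hJM⟩ := s.exists_isQuasiMaximal_ge hJ h1
  obtain ⟨b, hb, hbE⟩ := h M hM
  exact hb (hJM hbE)

theorem finiteType_one (s : SemistarOperation D K) : s.finiteType 1 = s 1 := by
  have h1 : (1 : Submodule D K) ≠ ⊥ := one_ne_zero
  refine le_antisymm (sSup_le ?_)
    (le_sSup ⟨1, ⟨h1, by rw [Submodule.one_eq_span]; exact Submodule.fg_span_singleton 1, le_rfl⟩,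
      rfl⟩)
  rintro _ ⟨F, ⟨h0, -, hF⟩, rfl⟩
  exact s.mono' _ _ h0 h1 hF

/-! ### Localizations of a P⋆MD, via the submodules `F = D + Dx`. -/

theorem span_one_pair_ne_bot (x : K) : Submodule.span D {1, x} ≠ ⊥ :=
  (Submodule.ne_bot_iff _).mpr ⟨1, Submodule.subset_span (by simp), one_ne_zero⟩

theorem mem_one_div_span_pair {x y : K} :
    y ∈ 1 / Submodule.span D {1, x} ↔ y ∈ (1 : Submodule D K) ∧ y * x ∈ (1 : Submodule D K) := by
  rw [Submodule.mem_div_iff_forall_mul_mem]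
  constructor
  · intro h
    exact ⟨by simpa using h 1 (Submodule.subset_span (by simp)),
      h x (Submodule.subset_span (by simp))⟩
  · rintro ⟨h1, h2⟩ z hz
    obtain ⟨a, b, rfl⟩ := Submodule.mem_span_pair.mp hz
    rw [mul_add, mul_smul_comm, mul_smul_comm, mul_one]
    exact Submodule.add_mem _ (Submodule.smul_mem _ _ h1) (Submodule.smul_mem _ _ h2)

theorem IsPStarMD.one_mem {s : SemistarOperation D K} (hP : s.IsPStarMD) {F : Submodule D K}
    (h0 : F ≠ ⊥) (hF : F.FG) : (1 : K) ∈ s.finiteType (F * (1 / F)) := by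
  rw [hP F h0 hF]
  exact s.finiteType.le_map' 1 one_ne_zero one_mem_one_submodule

theorem one_div_span_one_pair_ne_bot (x : K) : 1 / Submodule.span D {1, x} ≠ ⊥ := by
  obtain ⟨a, b, hb, rfl⟩ := IsFractionRing.div_surjective (A := D) x
  have hb0 : algebraMap D K b ≠ 0 := by simpa using nonZeroDivisors.ne_zero hb
  refine (Submodule.ne_bot_iff _).mpr ⟨algebraMap D K b, mem_one_div_span_pair.mpr
    ⟨Submodule.mem_one.mpr ⟨b, rfl⟩, Submodule.mem_one.mpr ⟨a, by field_simp⟩⟩, hb0⟩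

theorem span_one_pair_mul_ne_bot (x : K) :
    Submodule.span D {1, x} * (1 / Submodule.span D {1, x}) ≠ ⊥ :=
  mul_ne_zero (span_one_pair_ne_bot x) (one_div_span_one_pair_ne_bot x)

/-- An element `p` of `F⁻¹` has `p` and `q = px` in `D`. If neither `x = q/p` nor `x⁻¹ = p/q` is in
`D_M`, then `p, q ∈ M`, so `F F⁻¹ ⊆ M`, contradicting `1 ∈ (F F⁻¹)^{⋆_f}`. -/
theorem IsPStarMD.mem_or_inv_mem_localizationAt {s : SemistarOperation D K} (hP : s.IsPStarMD)
    {M : Ideal D} (hM : s.finiteType.IsQuasiMaximal M) (x : K) (hx : x ≠ 0) :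
    x ∈ localizationAt K M ∨ x⁻¹ ∈ localizationAt K M := by
  by_contra! hcon
  have h1 := hP.one_mem (span_one_pair_ne_bot x) (Submodule.fg_span (Set.toFinite _))
  refine s.finiteType.one_notMem_map_of_isQuasiMaximal hM
    (s.finiteType.mono' _ _ (span_one_pair_mul_ne_bot x) (coeSubmodule_ne_bot hM.prop.1.1) ?_ h1)
  rw [Submodule.mul_le]
  intro f hf g hg
  obtain ⟨h1g, hxg⟩ := mem_one_div_span_pair.mp hg
  obtain ⟨p, rfl⟩ := Submodule.mem_one.mp h1g
  obtain ⟨q, hq⟩ := Submodule.mem_one.mp hxg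
  have hp : p ∈ M := by
    by_contra hp
    have hp0 := algebraMap_ne_zero_of_notMem (K := K) hp
    exact hcon.1 ⟨q, p, hp, by rw [hq]; field_simp⟩
  have hqM : q ∈ M := by
    by_contra hqM
    have hq0 := algebraMap_ne_zero_of_notMem (K := K) hqM
    refine hcon.2 ⟨p, q, hqM, ?_⟩
    rw [eq_div_iff hq0, hq]
    field_simp
  obtain ⟨a, b, rfl⟩ := Submodule.mem_span_pair.mp hf
  have e : (a • (1 : K) + b • x) * algebraMap D K p = algebraMap D K (a * p + b * q) := by
    rw [map_add, map_mul, map_mul, hq, Algebra.smul_def, Algebra.smul_def]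
    ring
  rw [e]
  exact algebraMap_mem_coeSubmodule.mpr (M.add_mem (M.mul_mem_left _ hp) (M.mul_mem_left _ hqM))

/-- With `F = D + Dz ⊆ D^⋆`, one gets `F F⁻¹ ⊆ (F⁻¹)^{⋆_f}`, so `1 ∈ (F⁻¹)^{⋆_f}`. But `F⁻¹` is the
ideal of denominators of `z`, which would lie in `M` if `z ∉ D_M`. -/
theorem IsPStarMD.map_one_subset_localizationAt {s : SemistarOperation D K} (hP : s.IsPStarMD)
    {M : Ideal D} (hM : s.finiteType.IsQuasiMaximal M) {z : K} (hz : z ∈ s 1) :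
    z ∈ localizationAt K M := by
  by_contra hcon
  have h1 := hP.one_mem (span_one_pair_ne_bot z) (Submodule.fg_span (Set.toFinite _))
  have hG0 := one_div_span_one_pair_ne_bot (D := D) z
  have hle : Submodule.span D {1, z} * (1 / Submodule.span D {1, z}) ≤
      s.finiteType (1 / Submodule.span D {1, z}) := by
    rw [Submodule.mul_le]
    intro f hf g hg
    refine s.finiteType.mul_mem_map_of_mem_map_one hG0 ?_ hg
    rw [finiteType_one]
    refine Submodule.span_le.mpr ?_ hf
    rintro y (rfl | rfl)
    · exact s.le_map' 1 one_ne_zero one_mem_one_submodule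
    · exact hz
  have h2 := s.finiteType.mono' _ _ (span_one_pair_mul_ne_bot z) (s.finiteType.map_ne_bot hG0) hle h1
  rw [s.finiteType.idem' _ hG0] at h2
  refine s.finiteType.one_notMem_map_of_isQuasiMaximal hM
    (s.finiteType.mono' _ _ hG0 (coeSubmodule_ne_bot hM.prop.1.1) ?_ h2)
  intro g hg
  obtain ⟨h1g, hzg⟩ := mem_one_div_span_pair.mp hg
  obtain ⟨p, rfl⟩ := Submodule.mem_one.mp h1g
  obtain ⟨q, hq⟩ := Submodule.mem_one.mp hzg
  refine algebraMap_mem_coeSubmodule.mpr ?_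
  by_contra hp
  have hp0 := algebraMap_ne_zero_of_notMem (K := K) hp
  exact hcon ⟨q, p, hp, by rw [hq]; field_simp⟩

/-! ### The main argument. -/

theorem IsPStarMD.isIdempotent {s : SemistarOperation D K} (hP : s.IsPStarMD)
    (hsharp : s.finiteType.IsSharp) {I : Ideal D} (hI : I ≠ ⊥)
    (hdiv : s 1 / coeSubmodule K I = s 1) :
    s.finiteType.IsIdempotent (coeSubmodule K I) := by
  have hI0 := coeSubmodule_ne_bot (K := K) hI
  have hI2 : I ^ 2 ≠ ⊥ := pow_ne_zero 2 hI
  have hI20 := coeSubmodule_ne_bot (K := K) hI2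
  unfold IsIdempotent
  rw [coeSubmodule_pow_two]
  refine le_antisymm ?_ (s.finiteType.mono' _ _ hI20 hI0
    (coeSubmodule_mono K (Ideal.pow_le_self two_ne_zero)))
  rw [← s.finiteType.idem' _ hI20]
  refine s.finiteType.mono' _ _ hI0 (s.finiteType.map_ne_bot hI20) ?_
  intro _ hxI
  obtain ⟨x, hx, rfl⟩ := (mem_coeSubmodule K I).mp hxI
  refine s.mem_finiteType_of_forall_isQuasiMaximal hI20 fun M hM => ?_
  by_contra! hcon
  have hV := hP.mem_or_inv_mem_localizationAt hM
  obtain ⟨z, hz, hzI⟩ := exists_notMem_localizationAt_of_not_idempotent hM.isPrime hV hx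
    fun b hb hbx => hcon b hb (by
      rw [← map_mul, mul_comm]
      exact algebraMap_mem_coeSubmodule.mpr hbx)
  obtain ⟨y, hy, hyM, hyI⟩ := s.finiteType.exists_mem_theta_notMem_localizationAt
    (fun N hN => hN.isPrime) hM hV (hsharp M hM) hz hzI
  refine hyM (hP.map_one_subset_localizationAt hM ?_)
  rw [← hdiv, Submodule.mem_div_iff_forall_mul_mem]
  intro w hw
  obtain ⟨i, hi, rfl⟩ := (mem_coeSubmodule K I).mp hw
  rw [← finiteType_one]
  refine s.mem_finiteType_of_forall_isQuasiMaximal one_ne_zero fun N hN => ?_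
  -- Distinct quasi-maximal ideals are incomparable, so every `N ≠ M` belongs to `nabla M`.
  have hyN : y * algebraMap D K i ∈ localizationAt K N := by
    by_cases hMN : M ≤ N
    · exact hM.eq_of_le hN hMN ▸ hyI i hi
    · exact mul_mem_localizationAt hN.isPrime (Set.mem_iInter₂.mp hy N ⟨hN, hMN⟩)
        (algebraMap_mem_localizationAt hN.isPrime i)
  obtain ⟨a, b, hb, hab⟩ := hyN
  have hb0 := algebraMap_ne_zero_of_notMem (K := K) hb
  exact ⟨b, hb, Submodule.mem_one.mpr ⟨a, ((eq_div_iff hb0).mp hab).symm⟩⟩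

/-! ### The `v`-operation and P`v`MDs. -/

theorem one_div_one : (1 : Submodule D K) / 1 = 1 := by
  ext x
  rw [Submodule.mem_div_iff_forall_mul_mem]
  constructor
  · intro h
    simpa using h 1 one_mem_one_submodule
  · intro hx y hy
    have := Submodule.mul_mem_mul hx hy
    rwa [mul_one] at this

theorem vOperation_one : vOperation D K 1 = 1 := by
  change (1 : Submodule D K) / (1 / 1) = 1
  rw [one_div_one, one_div_one]

/-- Clearing denominators bridges `IsPvMD`, which tests ideals of `D`, and `IsPStarMD`, which tests
submodules of `K`; `F F⁻¹` does not change under scaling. -/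
theorem exists_smul_eq_coeSubmodule {F : Submodule D K} (h0 : F ≠ ⊥) (hF : F.FG) :
    ∃ x : K, x ≠ 0 ∧ ∃ I : Ideal D, I ≠ ⊥ ∧ I.FG ∧ x • F = coeSubmodule K I := by
  obtain ⟨T, rfl⟩ := hF
  obtain ⟨b, hb⟩ := exist_integer_multiples_of_finset (nonZeroDivisors D) T
  have hb0 : algebraMap D K b ≠ 0 := by simp
  let F := Submodule.span D (T : Set K)
  have hle : algebraMap D K b • F ≤ LinearMap.range (Algebra.linearMap D K) := by
    rintro _ ⟨y, hy, rfl⟩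
    have : F ≤ (LinearMap.range (Algebra.linearMap D K)).comap
        (LinearMap.mulLeft D (algebraMap D K b)) := by
      refine Submodule.span_le.mpr fun t ht => ?_
      obtain ⟨c, hc⟩ := hb t ht
      exact ⟨c, by rw [LinearMap.mulLeft_apply, ← Algebra.smul_def]; exact hc⟩
    exact this hy
  let I : Ideal D := (algebraMap D K b • F).comap (Algebra.linearMap D K)
  have hI : coeSubmodule K I = algebraMap D K b • F := Submodule.map_comap_eq_of_le hle
  have hinj : Function.Injective (Algebra.linearMap D K) := IsFractionRing.injective D K
  refine ⟨algebraMap D K b, hb0, I, fun h => ?_, ?_, hI.symm⟩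
  · apply smul_ne_bot hb0 h0
    change algebraMap D K b • F = ⊥
    rw [← hI, h]
    exact Submodule.map_bot _
  · refine Submodule.fg_of_fg_map_injective _ hinj ?_
    change (coeSubmodule K I).FG
    rw [hI]
    exact fg_smul _ ⟨T, rfl⟩

theorem smul_mul_one_div_smul {x : K} (hx : x ≠ 0) (F : Submodule D K) :
    (x • F) * (1 / (x • F)) = F * (1 / F) := by
  rw [one_div_smul hx]
  have h : ∀ {y : K}, y ≠ 0 → ∀ A B : Submodule D K, (y • A) * (y⁻¹ • B) ≤ A * B := by
    intro y hy A B
    rw [Submodule.mul_le]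
    rintro _ ⟨a, ha, rfl⟩ _ ⟨b, hb, rfl⟩
    have e : (y • a) * (y⁻¹ • b) = a * b := by
      rw [smul_eq_mul, smul_eq_mul]
      field_simp
    exact (congrArg (· ∈ A * B) e).mpr (Submodule.mul_mem_mul ha hb)
  refine le_antisymm (h hx _ _) ?_
  have := h (inv_ne_zero hx) (x • F) (x⁻¹ • (1 / F))
  rwa [inv_inv, inv_smul_smul₀ hx, smul_inv_smul₀ hx] at this

theorem IsPvMD.isPStarMD (h : IsPvMD D K) : (vOperation D K).IsPStarMD := by
  intro F h0 hF
  obtain ⟨x, hx, I, hI0, hI, e⟩ := exists_smul_eq_coeSubmodule h0 hF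
  rw [finiteType_one, vOperation_one, ← smul_mul_one_div_smul hx F, e]
  exact h I hI0 hI

end

end SemistarOperation

theorem mainTheorem7 {D K : Type*} [CommRing D] [IsDomain D] [Field K] [Algebra D K]
    [IsFractionRing D K] :
    (∀ s : SemistarOperation D K, s.finiteType.IsSharp → s.IsPStarMD →
      ∀ I : Ideal D, I ≠ ⊥ →
        s 1 / IsLocalization.coeSubmodule K I = s 1 →
        s.finiteType.IsIdempotent (IsLocalization.coeSubmodule K I)) ∧
    ((SemistarOperation.tOperation D K).IsSharp → SemistarOperation.IsPvMD D K →
      ∀ I : Ideal D, I ≠ ⊥ →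
        (1 : Submodule D K) / IsLocalization.coeSubmodule K I = 1 →
        (SemistarOperation.tOperation D K).IsIdempotent (IsLocalization.coeSubmodule K I)) := by
  refine ⟨fun s hsharp hP I hI hdiv => hP.isIdempotent hsharp hI hdiv,
    fun hsharp hP I hI hdiv => hP.isPStarMD.isIdempotent hsharp hI ?_⟩
  rw [SemistarOperation.vOperation_one]
  exact hdiv
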